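/- Let $H$ be a complete Heyting algebra (a frame) and let $DH$ be the complete Heyting algebra of its down-closed subsets, ordered by inclusion; write $h^\dagger=\{k\mid k\le h\}$. \emph{Sheaves.} For a presheaf $F:H^{op}\to\mathbf{Set}$ and $A\subseteq H$, a matching family for $A$ is a family $(x_k)_{k\in A}$, $x_k\in F(k)$, with $x_k|_{k\wedge l}=x_l|_{k\wedge l}$ for all $k,l\in A$; $F$ is a sheaf if for every $A\subseteq H$ every matching family for $A$ has a unique amalgamation $x\in F(\bigvee A)$, i.e. $x|_k=x_k$ for all $k\in A$. $\mathbf{SHV}(H)$ is the full subcategory of sheaves in $\mathbf{Set}^{H^{op}}$. \emph{Relational-(pre)sheaves.} A pre-transformation $\tau:A\to B$ between sets is a family of relations $\tau_h\subseteq B\times A$ $(h\in H)$. It is order-preserving if every set $\{h\mid \tau_h(b,a)\}$ is down-closed, and infima-preserving if every such set is a principal down-closed set. In the semicategory $PT_{\mathrm{Ord}}(H)$ of sets and order-preserving pre-transformations, $(\sigma\tau)_h(c,a)$ holds iff there are $k,l$ with $h\le k\wedge l$ and $(\sigma_k\circ\tau_l)(c,a)$; in the semicategory $PT_{\inf}(H)$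 of sets and infima-preserving pre-transformations, it holds iff there is a family $(k_i,l_i)_{i\in I}$ with $h\le\bigvee_i(k_i\wedge l_i)$ and $(\sigma_{k_i}\circ\tau_{l_i})(c,a)$ for all $i$. Both are ordered by $\tau\le\sigma$ iff $\tau_h\subseteq\sigma_h$ for all $h$, with involution $(\tau^*)_h=\tau_h^{-1}$. For an involutive order-enriched semicategory $\mathcal O$, $\mathbf{Kar}^*(\mathcal O)$ is the category whose objects are the arrows $e$ with $e^*=e=ee$ and whose arrows $e\to e'$ are the $\varphi$ with $\varphi e=\varphi=e'\varphi$; $\mathbf{Map}^*$ of an involutive order-enriched category keeps all objects and those arrows $f$ with $1\le f^*f$ and $ff^*\le 1$. Put $\mathbf{Rel}^{H^{co}}_{\mathrm{Ord}}=\mathbf{Map}^*(\mathbf{Kar}^*(PT_{\mathrm{Ord}}(H)))$ (relational-presheaves) and $\mathbf{Rel}^{H^{co}}_{\inf}=\mathbf{Map}^*(\mathbf{Kar}^*(PT_{\inf}(H)))$ (relational-sheaves). \emph{Functors.} \begin{itemize} \item $\Gamma:\mathbf{Set}^{H^{op}}\to\mathbf{SHV}(DH)$, $\Gamma(F)(A)$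 the set of matching families for $A$, and $\Lambda:\mathbf{SHV}(DH)\to\mathbf{Set}^{H^{op}}$, $\Lambda(F)(h)=F(h^\dagger)$, with the evident actions on arrows. \item $\Psi:\mathbf{Rel}^{H^{co}}_{\mathrm{Ord}}\to\mathbf{Rel}^{DH^{co}}_{\inf}$ and $\Phi$ in the other direction, the identity on underlying sets, with $\Psi(\tau)_X(b,a)$ iff $\tau_h(b,a)$ for all $h\in X$, and $\Phi(\tau)_h(b,a)$ iff $\tau_{h^\dagger}(b,a)$. \item $\Delta_{\inf}:\mathbf{Set}^{H^{op}}\to\mathbf{Rel}^{H^{co}}_{\inf}$: the underlying set of $\Delta_{\inf}(F)$ is $\coprod_hF(h)$; for $b\in F(l)$, $a\in F(k)$, $\Delta_{\inf}(F)_h(b,a)$ holds iff $h\le\bigvee\{m\le k\wedge l\mid b|_m=a|_m\}$; for $\tau:F\to G$, $b\in G(l)$, $a\in F(k)$, $\Delta_{\inf}(\tau)_h(b,a)$ holds iff $h\le\bigvee\{m\le k\wedge l\mid b|_m=\tau_k(a)|_m\}$. \item $\Theta_{\inf}:\mathbf{Rel}^{H^{co}}_{\inf}\to\mathbf{Set}^{H^{op}}$: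 $\Theta_{\inf}(F)(h)=\mathrm{Hom}(F_h,F)$, where $F_h$ is the relational-sheaf on a one-point set with $(F_h)_k(*,*)$ iff $k\le h$; restriction along $k\le h$ is composition with the morphism $F_k\to F_h$ whose $l$-th relation holds iff $l\le k$, and $\Theta_{\inf}(\tau)$ is composition with $\tau$. It takes values in sheaves. \item $\Delta_{\mathbf{Shv}}:\mathbf{SHV}(H)\to\mathbf{Rel}^{H^{co}}_{\inf}$ is the restriction of $\Delta_{\inf}$ and $\Theta_{\mathbf{Shv}}:\mathbf{Rel}^{H^{co}}_{\inf}\to\mathbf{SHV}(H)$ the corestriction of $\Theta_{\inf}$; these are also used with $DH$ in place of $H$. \end{itemize} Put $\Delta_{\mathbf{Pre}}=\Phi\circ\Delta_{\mathbf{Shv}}\circ\Gamma$, $\Theta_{\mathbf{Pre}}=\Lambda\circ\Theta_{\mathbf{Shv}}\circ\Psi$ (with $\Delta_{\mathbf{Shv}},\Theta_{\mathbf{Shv}}$ for $DH$), $a_{\mathbf{Shv}}=\Theta_{\mathbf{Shv}}\circ\Delta_{\inf}$ and $a_{\mathbf{Rel}}=\Delta_{\inf}\circ\Theta_{\mathbf{Pre}}$.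 \textbf{Theorem.} \begin{enumerate} \item $\Delta_{\mathbf{Pre}}:\mathbf{Set}^{H^{op}}\to\mathbf{Rel}^{H^{co}}_{\mathrm{Ord}}$ is an equivalence of categories with quasi-inverse $\Theta_{\mathbf{Pre}}$. Moreover each factor is an equivalence: $\Gamma:\mathbf{Set}^{H^{op}}\to\mathbf{SHV}(DH)$ with quasi-inverse $\Lambda$, $\Delta_{\mathbf{Shv}}:\mathbf{SHV}(DH)\to\mathbf{Rel}^{DH^{co}}_{\inf}$ with quasi-inverse $\Theta_{\mathbf{Shv}}$, and $\Phi:\mathbf{Rel}^{DH^{co}}_{\inf}\to\mathbf{Rel}^{H^{co}}_{\mathrm{Ord}}$ with quasi-inverse $\Psi$. \item The associated sheaf functor $a_{\mathbf{Shv}}:\mathbf{Set}^{H^{op}}\to\mathbf{SHV}(H)$ is left adjoint to $\Theta_{\inf}\circ\Delta_{\mathbf{Shv}}:\mathbf{SHV}(H)\to\mathbf{Set}^{H^{op}}$, and the latter is naturally isomorphic to the inclusion of sheaves into presheaves. \item The associated relational-sheaf functor $a_{\mathbf{Rel}}:\mathbf{Rel}^{H^{co}}_{\mathrm{Ord}}\to\mathbf{Rel}^{H^{co}}_{\inf}$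 is left adjoint to $\Delta_{\mathbf{Pre}}\circ\Theta_{\inf}:\mathbf{Rel}^{H^{co}}_{\inf}\to\mathbf{Rel}^{H^{co}}_{\mathrm{Ord}}$. \end{enumerate} -/

import Mathlib

open CategoryTheory Opposite

universe w v u

namespace RelSh

/-! ### Involutive order-enriched semicategories and categories -/

/-- An involutive order-enriched semicategory: hom-sets are partial orders, composition is
associative and order-preserving (there need not be identities), and there is an
order-preserving contravariant involution which is the identity on objects.
`comp f g` is "first `f`, then `g`", i.e. `g ∘ f`. -/
class InvOrdSemicategory (C : Type w) where
  Hom : C → C → Type v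
  homOrder : ∀ A B : C, PartialOrder (Hom A B)
  comp : ∀ {A B D : C}, Hom A B → Hom B D → Hom A D
  assoc : ∀ {A B D E : C} (f : Hom A B) (g : Hom B D) (h : Hom D E),
    comp (comp f g) h = comp f (comp g h)
  comp_mono : ∀ {A B D : C} {f f' : Hom A B} {g g' : Hom B D},
    f ≤ f' → g ≤ g' → comp f g ≤ comp f' g'
  star : ∀ {A B : C}, Hom A B → Hom B A
  star_star : ∀ {A B : C} (f : Hom A B), star (star f) = f
  star_comp : ∀ {A B D : C} (f : Hom A B) (g : Hom B D),
    star (comp f g) = comp (star g) (star f)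
  star_mono : ∀ {A B : C} {f g : Hom A B}, f ≤ g → star f ≤ star g

namespace InvOrdSemicategory
attribute [reducible, instance] InvOrdSemicategory.homOrder
end InvOrdSemicategory

/-- An involutive order-enriched category. -/
class InvOrdCategory (O : Type w) [Category.{v} O] where
  homOrder : ∀ A B : O, PartialOrder (A ⟶ B)
  comp_mono : ∀ {A B D : O} {f f' : A ⟶ B} {g g' : B ⟶ D},
    f ≤ f' → g ≤ g' → f ≫ g ≤ f' ≫ g'
  star : ∀ {A B : O}, (A ⟶ B) → (B ⟶ A)
  star_star : ∀ {A B : O} (f : A ⟶ B), star (star f) = f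
  star_id : ∀ A : O, star (𝟙 A) = 𝟙 A
  star_comp : ∀ {A B D : O} (f : A ⟶ B) (g : B ⟶ D), star (f ≫ g) = star g ≫ star f
  star_mono : ∀ {A B : O} {f g : A ⟶ B}, f ≤ g → star f ≤ star g

namespace InvOrdCategory
attribute [reducible, instance] InvOrdCategory.homOrder
end InvOrdCategory

/-! ### The symmetric Karoubian envelope `Kar*` -/

section Kar

open InvOrdSemicategory

/-- Objects of `Kar*(C)`: symmetric idempotent arrows of `C`. -/
structure KarStar (C : Type w) [InvOrdSemicategory.{w, v} C] where
  carrier : C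
  e : InvOrdSemicategory.Hom carrier carrier
  symm : star e = e
  idem : comp e e = e

variable {C : Type w} [InvOrdSemicategory.{w, v} C]

/-- Arrows `f ⟶ g` of `Kar*(C)`: arrows `φ` of `C` with `φ ∘ f = φ = g ∘ φ`. -/
@[ext]
structure KarStar.Hom (f g : KarStar C) where
  φ : InvOrdSemicategory.Hom f.carrier g.carrier
  left : comp f.e φ = φ
  right : comp φ g.e = φ

instance : Category.{v} (KarStar C) where
  Hom := KarStar.Hom
  id f := ⟨f.e, f.idem, f.idem⟩
  comp φ ψ := ⟨comp φ.φ ψ.φ, by rw [← assoc, φ.left], by rw [assoc, ψ.right]⟩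
  id_comp φ := KarStar.Hom.ext φ.left
  comp_id φ := KarStar.Hom.ext φ.right
  assoc φ ψ χ := KarStar.Hom.ext (assoc φ.φ ψ.φ χ.φ)

instance : InvOrdCategory (KarStar C) where
  homOrder f g := PartialOrder.lift (fun φ : KarStar.Hom f g => φ.φ)
    (fun _ _ h => KarStar.Hom.ext h)
  comp_mono h h' := comp_mono (C := C) h h'
  star {f g} φ := ⟨star φ.φ, by conv_lhs => rw [← g.symm, ← star_comp, φ.right],
    by conv_lhs => rw [← f.symm, ← star_comp, φ.left]⟩
  star_star φ := KarStar.Hom.ext (star_star φ.φ)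
  star_id f := KarStar.Hom.ext f.symm
  star_comp φ ψ := KarStar.Hom.ext (star_comp φ.φ ψ.φ)
  star_mono h := star_mono (C := C) h

end Kar

/-! ### The category `Map*` of symmetric maps -/

section Map

open InvOrdCategory

/-- Objects of `Map*(O)`: all objects of `O`. -/
structure MapStar (O : Type w) where
  of : O

variable {O : Type w} [Category.{v} O] [InvOrdCategory O]

/-- Arrows of `Map*(O)`: symmetric maps, i.e. `1 ≤ f* ∘ f` and `f ∘ f* ≤ 1`. -/
@[ext]
structure MapStar.Hom (A B : MapStar O) where
  f : A.of ⟶ B.of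
  total : 𝟙 A.of ≤ f ≫ star f
  single : star f ≫ f ≤ 𝟙 B.of

instance : Category.{v} (MapStar O) where
  Hom := MapStar.Hom
  id A := ⟨𝟙 A.of, by rw [star_id, Category.id_comp], by rw [star_id, Category.id_comp]⟩
  comp {A B D} f g := ⟨f.f ≫ g.f,
    by
      have h := comp_mono (le_refl f.f) (comp_mono g.total (le_refl (star f.f)))
      rw [Category.id_comp] at h
      rw [star_comp]
      simpa only [Category.assoc] using f.total.trans h,
    by
      have h := comp_mono (le_refl (star g.f)) (comp_mono f.single (le_refl g.f))
      rw [Category.id_comp] at h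
      rw [star_comp]
      simpa only [Category.assoc] using h.trans g.single⟩
  id_comp f := MapStar.Hom.ext (Category.id_comp f.f)
  comp_id f := MapStar.Hom.ext (Category.comp_id f.f)
  assoc f g h := MapStar.Hom.ext (Category.assoc f.f g.f h.f)

end Map

/-! ### Semifunctors of involutive order-enriched semicategories -/

section Semifunctor

open InvOrdSemicategory

/-- A semifunctor which preserves the order and the involution. -/
structure InvOrdSemifunctor (C : Type w) [InvOrdSemicategory.{w, v} C]
    (D : Type w) [InvOrdSemicategory.{w, v} D] where
  obj : C → D
  map : ∀ {A B : C}, InvOrdSemicategory.Hom A B → InvOrdSemicategory.Hom (obj A) (obj B)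
  map_comp : ∀ {A B E : C} (f : InvOrdSemicategory.Hom A B) (g : InvOrdSemicategory.Hom B E),
    map (comp f g) = comp (map f) (map g)
  map_star : ∀ {A B : C} (f : InvOrdSemicategory.Hom A B), map (star f) = star (map f)
  map_mono : ∀ {A B : C} {f g : InvOrdSemicategory.Hom A B}, f ≤ g → map f ≤ map g

variable {C : Type w} [InvOrdSemicategory.{w, v} C] {D : Type w} [InvOrdSemicategory.{w, v} D]

/-- The functor `Map*(Kar*(C)) ⥤ Map*(Kar*(D))` induced by a semifunctor. -/
def InvOrdSemifunctor.mapKar (T : InvOrdSemifunctor C D) :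
    MapStar (KarStar C) ⥤ MapStar (KarStar D) where
  obj X := ⟨⟨T.obj X.of.carrier, T.map X.of.e, by rw [← T.map_star, X.of.symm],
    by rw [← T.map_comp, X.of.idem]⟩⟩
  map {X Y} f := ⟨⟨T.map f.f.φ, (T.map_comp _ _).symm.trans (congrArg T.map f.f.left),
    (T.map_comp _ _).symm.trans (congrArg T.map f.f.right)⟩,
    by
      have h : T.map X.of.e ≤ T.map (comp f.f.φ (star f.f.φ)) := T.map_mono f.total
      rw [T.map_comp, T.map_star] at h
      exact h,
    by
      have h : T.map (comp (star f.f.φ) f.f.φ) ≤ T.map Y.of.e := T.map_mono f.single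
      rw [T.map_comp, T.map_star] at h
      exact h⟩
  map_id _ := rfl
  map_comp f g := MapStar.Hom.ext (KarStar.Hom.ext (T.map_comp f.f.φ g.f.φ))

end Semifunctor

/-! ### Pre-transformations -/

section PreTransformation

/-- An order-preserving pre-transformation `A → B`: an `H`-indexed family of relations
(`rel h b a` is `τ_h(b, a) = 1`) such that every set `{h | τ_h(b, a) = 1}` is down-closed. -/
@[ext]
structure OrdPT (H : Type u) [Order.Frame H] (A B : Type u) where
  rel : H → B → A → Prop
  lower : ∀ a b, IsLowerSet {h | rel h b a}

/-- An infima-preserving pre-transformation `A → B`: an `H`-indexed family of relations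
such that every set `{h | τ_h(b, a) = 1}` is a principal down-closed set. -/
@[ext]
structure InfPT (H : Type u) [Order.Frame H] (A B : Type u) where
  rel : H → B → A → Prop
  principal : ∀ a b, ∃ m : H, {h | rel h b a} = Set.Iic m

/-- The objects of `PT_Ord(H)`: sets. -/
structure PTOrd (H : Type u) where
  set : Type u

/-- The objects of `PT_inf(H)`: sets. -/
structure PTInf (H : Type u) where
  set : Type u

variable {H : Type u} [Order.Frame H]

/-- The composite `σ ∘ τ` of order-preserving pre-transformations. -/
def OrdPT.comp {A B D : Type u} (τ : OrdPT H A B) (σ : OrdPT H B D) : OrdPT H A D where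
  rel h c a := ∃ k l : H, h ≤ k ⊓ l ∧ ∃ b, σ.rel k c b ∧ τ.rel l b a
  lower := by
    rintro a c h h' hh ⟨k, l, hkl, hb⟩
    exact ⟨k, l, hh.trans hkl, hb⟩

theorem OrdPT.comp_rel {A B D : Type u} (τ : OrdPT H A B) (σ : OrdPT H B D) (h : H) (c : D)
    (a : A) : (τ.comp σ).rel h c a ↔ ∃ b, σ.rel h c b ∧ τ.rel h b a := by
  constructor
  · rintro ⟨k, l, hkl, b, h1, h2⟩
    exact ⟨b, σ.lower b c (hkl.trans inf_le_left) h1, τ.lower a b (hkl.trans inf_le_right) h2⟩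
  · rintro ⟨b, h1, h2⟩
    exact ⟨h, h, by simp, b, h1, h2⟩

theorem OrdPT.ext_iff' {A B : Type u} {τ σ : OrdPT H A B}
    (h : ∀ k b a, τ.rel k b a ↔ σ.rel k b a) : τ = σ :=
  OrdPT.ext (funext fun k => funext fun b => funext fun a => propext (h k b a))

/-- `PT_Ord(H)`, with `τ ≤ σ` when `τ_h ⊆ σ_h` for all `h`, and `(τ*)_h` the inverse of `τ_h`. -/
instance : InvOrdSemicategory.{u + 1, u} (PTOrd H) where
  Hom A B := OrdPT H A.set B.set
  homOrder A B := PartialOrder.lift OrdPT.rel (fun _ _ h => OrdPT.ext h)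
  comp := OrdPT.comp
  assoc f g h := OrdPT.ext_iff' fun k b a => by
    simp only [OrdPT.comp_rel]
    constructor
    · rintro ⟨x, h1, y, h2, h3⟩
      exact ⟨y, ⟨x, h1, h2⟩, h3⟩
    · rintro ⟨y, ⟨x, h1, h2⟩, h3⟩
      exact ⟨x, h1, y, h2, h3⟩
  comp_mono h h' := by
    rintro m c a ⟨k, l, hkl, b, h1, h2⟩
    exact ⟨k, l, hkl, b, h' _ _ _ h1, h _ _ _ h2⟩
  star τ := ⟨fun h a b => τ.rel h b a, fun b a => τ.lower a b⟩
  star_star _ := rfl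
  star_comp f g := OrdPT.ext_iff' fun k b a => by
    refine (OrdPT.comp_rel f g k a b).trans (Iff.trans ?_ (OrdPT.comp_rel _ _ k b a).symm)
    exact ⟨fun ⟨x, h1, h2⟩ => ⟨x, h2, h1⟩, fun ⟨x, h1, h2⟩ => ⟨x, h2, h1⟩⟩
  star_mono h := fun m a b => h m b a

/-- The generator `⋁ {h | τ_h(b, a) = 1}` of the principal down-closed set at `(b, a)`. -/
def InfPT.val {A B : Type u} (τ : InfPT H A B) (b : B) (a : A) : H := sSup {h | τ.rel h b a}

theorem InfPT.rel_iff {A B : Type u} (τ : InfPT H A B) (h : H) (b : B) (a : A) :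
    τ.rel h b a ↔ h ≤ τ.val b a := by
  obtain ⟨m, hm⟩ := τ.principal a b
  have h1 : τ.rel h b a ↔ h ∈ {h | τ.rel h b a} := Iff.rfl
  rw [h1, InfPT.val, hm, csSup_Iic, Set.mem_Iic]

theorem InfPT.ext_val {A B : Type u} {τ σ : InfPT H A B} (h : ∀ b a, τ.val b a = σ.val b a) :
    τ = σ :=
  InfPT.ext (funext fun k => funext fun b => funext fun a => propext
    (by rw [τ.rel_iff, σ.rel_iff, h]))

/-- The pre-transformation of a matrix `M`: `τ_h(b, a) = 1` iff `h ≤ M(b, a)`. -/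
def InfPT.ofMatrix {A B : Type u} (M : B → A → H) : InfPT H A B where
  rel h b a := h ≤ M b a
  principal a b := ⟨M b a, rfl⟩

@[simp]
theorem InfPT.val_ofMatrix {A B : Type u} (M : B → A → H) (b : B) (a : A) :
    (InfPT.ofMatrix M).val b a = M b a := csSup_Iic

theorem InfPT.comp_aux {A B D : Type u} (τ : InfPT H A B) (σ : InfPT H B D) (h : H) (c : D)
    (a : A) : (∃ (I : Type u) (k l : I → H), h ≤ ⨆ i, k i ⊓ l i ∧
      ∀ i, ∃ b, σ.rel (k i) c b ∧ τ.rel (l i) b a) ↔ h ≤ ⨆ b, σ.val c b ⊓ τ.val b a := by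
  constructor
  · rintro ⟨I, k, l, hkl, hb⟩
    refine hkl.trans (iSup_le fun i => ?_)
    obtain ⟨b, h1, h2⟩ := hb i
    exact (inf_le_inf ((σ.rel_iff _ _ _).1 h1) ((τ.rel_iff _ _ _).1 h2)).trans
      (le_iSup (fun b => σ.val c b ⊓ τ.val b a) b)
  · intro hh
    exact ⟨B, fun b => σ.val c b, fun b => τ.val b a, hh,
      fun b => ⟨b, (σ.rel_iff _ _ _).2 le_rfl, (τ.rel_iff _ _ _).2 le_rfl⟩⟩

/-- The composite `σ ∘ τ` of infima-preserving pre-transformations. -/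
def InfPT.comp {A B D : Type u} (τ : InfPT H A B) (σ : InfPT H B D) : InfPT H A D where
  rel h c a := ∃ (I : Type u) (k l : I → H), h ≤ ⨆ i, k i ⊓ l i ∧
    ∀ i, ∃ b, σ.rel (k i) c b ∧ τ.rel (l i) b a
  principal a c := ⟨⨆ b, σ.val c b ⊓ τ.val b a, Set.ext fun h => InfPT.comp_aux τ σ h c a⟩

theorem InfPT.val_comp {A B D : Type u} (τ : InfPT H A B) (σ : InfPT H B D) (c : D) (a : A) :
    (τ.comp σ).val c a = ⨆ b, σ.val c b ⊓ τ.val b a :=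
  eq_of_forall_le_iff fun h => by
    rw [← InfPT.rel_iff]
    exact InfPT.comp_aux τ σ h c a

/-- The inverse of every relation in the family. -/
def InfPT.inv {A B : Type u} (τ : InfPT H A B) : InfPT H B A where
  rel h a b := τ.rel h b a
  principal b a := τ.principal a b

theorem InfPT.val_inv {A B : Type u} (τ : InfPT H A B) (a : A) (b : B) :
    τ.inv.val a b = τ.val b a := rfl

instance {A B : Type u} : PartialOrder (InfPT H A B) :=
  PartialOrder.lift InfPT.rel (fun _ _ h => InfPT.ext h)

theorem InfPT.le_iff {A B : Type u} {τ σ : InfPT H A B} :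
    τ ≤ σ ↔ ∀ b a, τ.val b a ≤ σ.val b a := by
  constructor
  · intro h b a
    exact (σ.rel_iff _ _ _).1 (h _ b a ((τ.rel_iff _ _ _).2 le_rfl))
  · intro h k b a hk
    exact (σ.rel_iff _ _ _).2 (((τ.rel_iff _ _ _).1 hk).trans (h b a))

/-- `PT_inf(H)`, with `τ ≤ σ` when `τ_h ⊆ σ_h` for all `h`, and `(τ*)_h` the inverse of `τ_h`. -/
instance : InvOrdSemicategory.{u + 1, u} (PTInf H) where
  Hom A B := InfPT H A.set B.set
  homOrder A B := inferInstance
  comp := InfPT.comp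
  assoc f g h := InfPT.ext_val fun d a => by
    simp only [InfPT.val_comp, inf_iSup_eq, iSup_inf_eq, inf_assoc]
    exact iSup_comm
  comp_mono h h' := InfPT.le_iff.2 fun c a => by
    simp only [InfPT.val_comp]
    exact iSup_mono fun b => inf_le_inf (InfPT.le_iff.1 h' c b) (InfPT.le_iff.1 h b a)
  star := InfPT.inv
  star_star _ := rfl
  star_comp f g := InfPT.ext_val fun a c => by
    simp only [InfPT.val_comp, InfPT.val_inv]
    exact iSup_congr fun b => inf_comm _ _
  star_mono h := fun m a b => h m b a

end PreTransformation

/-! ### Relational-presheaves and relational-sheaves -/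

/-- The category `Rel^{H^co}_Ord = Map*(Kar*(PT_Ord(H)))` of relational-presheaves. -/
abbrev RelPresheaf (H : Type u) [Order.Frame H] := MapStar (KarStar (PTOrd H))

/-- The category `Rel^{H^co}_inf = Map*(Kar*(PT_inf(H)))` of relational-sheaves. -/
abbrev RelSheaf (H : Type u) [Order.Frame H] := MapStar (KarStar (PTInf H))

section Comparison

variable (H : Type u) [Order.Frame H]

/-- `Ψ : PT_Ord(H) → PT_inf(DH)`: `Ψ(τ)_X(b, a) = 1` iff `τ_h(b, a) = 1` for every `h ∈ X`. -/
def psiSemi : InvOrdSemifunctor (PTOrd H) (PTInf (LowerSet H)) where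
  obj A := ⟨A.set⟩
  map {A B} τ :=
    { rel := fun X b a => ∀ h ∈ X, OrdPT.rel τ h b a
      principal := fun a b => ⟨⟨{h | OrdPT.rel τ h b a}, OrdPT.lower τ a b⟩, rfl⟩ }
  map_comp {A B E} f g := InfPT.ext (funext fun X => funext fun c => funext fun a => propext (by
    constructor
    · intro hX
      have hX' : ∀ h : X, ∃ k l : H, h.1 ≤ k ⊓ l ∧ ∃ b, OrdPT.rel g k c b ∧ OrdPT.rel f l b a :=
        fun h => hX h.1 h.2
      choose k l hkl b h1 h2 using hX'
      refine ⟨X, fun h => LowerSet.Iic (k h), fun h => LowerSet.Iic (l h), ?_, fun h =>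
        ⟨b h, fun m hm => OrdPT.lower g (b h) c hm (h1 h),
          fun m hm => OrdPT.lower f a (b h) hm (h2 h)⟩⟩
      intro h hh
      rw [LowerSet.coe_iSup, Set.mem_iUnion]
      exact ⟨⟨h, hh⟩, (hkl ⟨h, hh⟩).trans inf_le_left, (hkl ⟨h, hh⟩).trans inf_le_right⟩
    · rintro ⟨I, K, L, hX, hb⟩ h hh
      have := hX hh
      rw [LowerSet.coe_iSup, Set.mem_iUnion] at this
      obtain ⟨i, hK, hL⟩ := this
      obtain ⟨b, h1, h2⟩ := hb i
      exact ⟨h, h, by simp, b, h1 h hK, h2 h hL⟩))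
  map_star _ := rfl
  map_mono h := fun X b a hX k hk => h k b a (hX k hk)

/-- `Φ : PT_inf(DH) → PT_Ord(H)`: `Φ(τ)_h(b, a) = 1` iff `τ_{h†}(b, a) = 1`. -/
def phiSemi : InvOrdSemifunctor (PTInf (LowerSet H)) (PTOrd H) where
  obj A := ⟨A.set⟩
  map {A B} τ :=
    { rel := fun h b a => InfPT.rel τ (LowerSet.Iic h) b a
      lower := fun a b h k hk hh => by
        have h1 : LowerSet.Iic h ≤ InfPT.val τ b a := (InfPT.rel_iff τ _ b a).1 hh
        exact (InfPT.rel_iff τ _ b a).2 ((LowerSet.Iic_le.2 hk).trans h1) }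
  map_comp {A B E} f g := OrdPT.ext_iff' fun h c a => by
    refine Iff.trans ?_ (OrdPT.comp_rel _ _ h c a).symm
    show InfPT.rel (InfPT.comp f g) (LowerSet.Iic h) c a ↔
      ∃ b, InfPT.rel g (LowerSet.Iic h) c b ∧ InfPT.rel f (LowerSet.Iic h) b a
    simp only [InfPT.rel_iff, InfPT.val_comp, LowerSet.Iic_le, LowerSet.mem_iSup_iff,
      LowerSet.mem_inf_iff]
  map_star _ := rfl
  map_mono h := fun k b a hk => h _ b a hk

/-- `Ψ : Rel^{H^co}_Ord ⥤ Rel^{DH^co}_inf`. -/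
def Psi : RelPresheaf H ⥤ RelSheaf (LowerSet H) := (psiSemi H).mapKar

/-- `Φ : Rel^{DH^co}_inf ⥤ Rel^{H^co}_Ord`. -/
def Phi : RelSheaf (LowerSet H) ⥤ RelPresheaf H := (phiSemi H).mapKar

end Comparison

/-! ### Presheaves and sheaves on a complete Heyting algebra -/

section Sheaves

variable {H : Type u} [Order.Frame H]

/-- The restriction `x|_k` of `x ∈ F(h)` for `k ≤ h`. -/
def res (F : Hᵒᵖ ⥤ Type u) {h k : H} (hk : k ≤ h) (x : F.obj (op h)) : F.obj (op k) :=
  F.map (homOfLE hk).op x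

theorem res_self (F : Hᵒᵖ ⥤ Type u) {h : H} (x : F.obj (op h)) : res F le_rfl x = x := by
  simp [res]

theorem res_res (F : Hᵒᵖ ⥤ Type u) {h k l : H} (hk : k ≤ h) (hl : l ≤ k) (x : F.obj (op h)) :
    res F hl (res F hk x) = res F (hl.trans hk) x := by
  have : (homOfLE (hl.trans hk)).op = (homOfLE hk).op ≫ (homOfLE hl).op := Subsingleton.elim _ _
  simp [res, this]

theorem app_res {F G : Hᵒᵖ ⥤ Type u} (τ : F ⟶ G) {h k : H} (hk : k ≤ h) (x : F.obj (op h)) :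
    τ.app (op k) (res F hk x) = res G hk (τ.app (op h) x) := by
  simp [res]

/-- Matching families `⟨x_k⟩_{k ∈ A}`: `x_k ∈ F(k)`, and `x_k`, `x_l` agree on `k ⊓ l`. -/
def MatchingFamily (F : Hᵒᵖ ⥤ Type u) (A : Set H) : Type u :=
  {x : ∀ k : A, F.obj (op k.1) //
    ∀ k l : A, res F inf_le_left (x k) = res F (k := k.1 ⊓ l.1) inf_le_right (x l)}

/-- `x ∈ F(⋁ A)` is an amalgamation of a matching family on `A` if `x|_k = x_k` for all `k`. -/
def IsAmalgamation (F : Hᵒᵖ ⥤ Type u) {A : Set H} (X : MatchingFamily F A)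
    (x : F.obj (op (sSup A))) : Prop :=
  ∀ k : A, res F (le_sSup k.2) x = X.1 k

/-- A presheaf is a sheaf if every matching family has a unique amalgamation. -/
def IsShf (F : Hᵒᵖ ⥤ Type u) : Prop :=
  ∀ (A : Set H) (X : MatchingFamily F A), ∃! x, IsAmalgamation F X x

variable (H) in
/-- The full subcategory of sheaves. -/
abbrev SHV := ObjectProperty.FullSubcategory (fun F : Hᵒᵖ ⥤ Type u => IsShf F)

variable (H) in
/-- The inclusion of sheaves into presheaves. -/
abbrev shvIncl : SHV H ⥤ (Hᵒᵖ ⥤ Type u) := ObjectProperty.ι _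

theorem MatchingFamily.res_eq {F : Hᵒᵖ ⥤ Type u} {A : Set H} (X : MatchingFamily F A)
    {k l : H} (hk : k ∈ A) (hl : l ∈ A) (h : k ≤ l) : res F h (X.1 ⟨l, hl⟩) = X.1 ⟨k, hk⟩ := by
  have h1 := X.2 ⟨k, hk⟩ ⟨l, hl⟩
  have h2 := congrArg (res F (le_inf le_rfl h)) h1
  simp only [res_res, res_self] at h2
  exact h2.symm

/-- Restriction of a matching family to a subset. -/
def MatchingFamily.restrict {F : Hᵒᵖ ⥤ Type u} {A B : Set H} (h : B ⊆ A)
    (X : MatchingFamily F A) : MatchingFamily F B :=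
  ⟨fun k => X.1 ⟨k.1, h k.2⟩, fun k l => X.2 ⟨k.1, h k.2⟩ ⟨l.1, h l.2⟩⟩

/-- The presheaf `Γ(F)` on the down-closed subsets of `H`: `Γ(F)(A)` is the set of
matching families for `A`. -/
def gammaObj (F : Hᵒᵖ ⥤ Type u) : (LowerSet H)ᵒᵖ ⥤ Type u where
  obj A := MatchingFamily F (A.unop : Set H)
  map f := ↾fun X => X.restrict (leOfHom f.unop)

theorem gammaObj_res (F : Hᵒᵖ ⥤ Type u) {A B : LowerSet H} (h : B ≤ A)
    (X : MatchingFamily F (A : Set H)) :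
    res (gammaObj F) h X = X.restrict h := rfl

theorem gammaObj_isShf (F : Hᵒᵖ ⥤ Type u) : IsShf (gammaObj F) := by
  intro 𝒜 X
  have key : ∀ (B : LowerSet H) (hB : B ∈ 𝒜) (C : LowerSet H) (hC : C ∈ 𝒜) (h : H)
      (h1 : h ∈ B) (h2 : h ∈ C), (X.1 ⟨B, hB⟩).1 ⟨h, h1⟩ = (X.1 ⟨C, hC⟩).1 ⟨h, h2⟩ := by
    intro B hB C hC h h1 h2
    exact congrFun (congrArg Subtype.val (X.2 ⟨B, hB⟩ ⟨C, hC⟩)) ⟨h, h1, h2⟩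
  have mem : ∀ h : ((sSup 𝒜 : LowerSet H) : Set H), ∃ B ∈ 𝒜, h.1 ∈ B := fun h =>
    LowerSet.mem_sSup_iff.1 h.2
  choose B hB hm using mem
  refine ⟨⟨fun h => (X.1 ⟨B h, hB h⟩).1 ⟨h.1, hm h⟩, fun k l => ?_⟩, fun C => ?_, ?_⟩
  · rw [MatchingFamily.res_eq (X.1 ⟨B k, hB k⟩) ((B k).lower inf_le_left (hm k)) (hm k),
      MatchingFamily.res_eq (X.1 ⟨B l, hB l⟩) ((B l).lower inf_le_right (hm l)) (hm l)]
    exact key _ _ _ _ _ _ _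
  · apply Subtype.ext
    funext h
    exact key _ _ _ _ _ _ _
  · intro Y hY
    apply Subtype.ext
    funext h
    exact congrFun (congrArg Subtype.val (hY ⟨B h, hB h⟩)) ⟨h.1, hm h⟩

variable (H) in
/-- The functor `Γ : Set^{H^op} ⥤ SHV(DH)`. -/
def Gamma : (Hᵒᵖ ⥤ Type u) ⥤ SHV (LowerSet H) where
  obj F := ⟨gammaObj F, gammaObj_isShf F⟩
  map {F G} τ := ObjectProperty.homMk
    { app := fun A => ↾fun X => (⟨fun k => τ.app (op k.1) (X.1 k), fun k l => by
        rw [← app_res, ← app_res, X.2 k l]⟩ : MatchingFamily G (A.unop : Set H)) }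

variable (H) in
/-- The functor `h ↦ h†` sending `h` to its principal down-closed set. -/
def principalFunctor : H ⥤ LowerSet H where
  obj h := LowerSet.Iic h
  map f := homOfLE (LowerSet.Iic_le.2 (leOfHom f))

variable (H) in
/-- The functor `Λ : SHV(DH) ⥤ Set^{H^op}`, `Λ(F)(h) = F(h†)`. -/
def Lambda : SHV (LowerSet H) ⥤ (Hᵒᵖ ⥤ Type u) :=
  shvIncl (LowerSet H) ⋙ (Functor.whiskeringLeft _ _ _).obj (principalFunctor H).op

end Sheaves

/-! ### The functor `Δ_inf` -/

section Delta

variable {H : Type u} [Order.Frame H]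

/-- The disjoint union `∐_h F(h)`. -/
abbrev Elts (F : Hᵒᵖ ⥤ Type u) : Type u := Σ h : H, F.obj (op h)

/-- For `b ∈ F(l)` and `a ∈ F(k)`, the supremum of the `m ≤ k ⊓ l` with `b|_m = a|_m`. -/
def agree (F : Hᵒᵖ ⥤ Type u) (b a : Elts F) : H :=
  sSup {m | ∃ (hb : m ≤ b.1) (ha : m ≤ a.1), res F hb b.2 = res F ha a.2}

/-- The action of a transformation of presheaves on elements. -/
def eltsMap {F G : Hᵒᵖ ⥤ Type u} (τ : F ⟶ G) (a : Elts F) : Elts G := ⟨a.1, τ.app (op a.1) a.2⟩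

theorem agree_symm (F : Hᵒᵖ ⥤ Type u) (b a : Elts F) : agree F b a = agree F a b := by
  unfold agree
  congr 1
  ext m
  exact ⟨fun ⟨h1, h2, h⟩ => ⟨h2, h1, h.symm⟩, fun ⟨h1, h2, h⟩ => ⟨h2, h1, h.symm⟩⟩

theorem agree_self (F : Hᵒᵖ ⥤ Type u) (a : Elts F) : agree F a a = a.1 :=
  le_antisymm (sSup_le fun _ ⟨h, _, _⟩ => h) (le_sSup ⟨le_rfl, le_rfl, rfl⟩)

theorem agree_le_right (F : Hᵒᵖ ⥤ Type u) (b a : Elts F) : agree F b a ≤ a.1 :=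
  sSup_le fun _ ⟨_, h, _⟩ => h

theorem agree_trans (F : Hᵒᵖ ⥤ Type u) (c b a : Elts F) :
    agree F c b ⊓ agree F b a ≤ agree F c a := by
  unfold agree
  rw [sSup_inf_sSup]
  refine iSup₂_le fun p hp => ?_
  obtain ⟨⟨h1, h2, h⟩, ⟨h1', h2', h'⟩⟩ := hp
  refine le_sSup ⟨inf_le_left.trans h1, inf_le_right.trans h2', ?_⟩
  rw [← res_res F h1 inf_le_left, h, ← res_res F h2' inf_le_right, ← h', res_res, res_res]

theorem agree_map {F G : Hᵒᵖ ⥤ Type u} (τ : F ⟶ G) (b a : Elts F) :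
    agree F b a ≤ agree G (eltsMap τ b) (eltsMap τ a) := by
  refine sSup_le_sSup fun m ⟨h1, h2, h⟩ => ⟨h1, h2, ?_⟩
  simp only [eltsMap]
  rw [← app_res, ← app_res, h]

/-- The family `Δ_inf(τ)`: `Δ_inf(τ)_h(b, a) = 1` iff `h` is below the supremum of the `m` for
which `b|_m = τ(a)|_m`. -/
def deltaPT {F G : Hᵒᵖ ⥤ Type u} (τ : F ⟶ G) : InfPT H (Elts F) (Elts G) :=
  InfPT.ofMatrix fun b a => agree G b (eltsMap τ a)

theorem deltaPT_comp {F G K : Hᵒᵖ ⥤ Type u} (τ : F ⟶ G) (σ : G ⟶ K) :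
    (deltaPT τ).comp (deltaPT σ) = deltaPT (τ ≫ σ) := by
  apply InfPT.ext_val
  intro c a
  simp only [InfPT.val_comp, deltaPT, InfPT.val_ofMatrix]
  have e : eltsMap (τ ≫ σ) a = eltsMap σ (eltsMap τ a) := rfl
  rw [e]
  apply le_antisymm
  · exact iSup_le fun b => (inf_le_inf le_rfl (agree_map σ b _)).trans (agree_trans K _ _ _)
  · refine le_trans (le_inf le_rfl ?_)
      (le_iSup (fun b => agree K c (eltsMap σ b) ⊓ agree G b (eltsMap τ a)) (eltsMap τ a))
    rw [agree_self]
    exact agree_le_right K _ _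

theorem eltsMap_id {F : Hᵒᵖ ⥤ Type u} (a : Elts F) : eltsMap (𝟙 F) a = a := by
  simp [eltsMap]

/-- The relational-sheaf `Δ_inf(F)`: its set is `∐_h F(h)`, and `Δ_inf(F)(h)(b, a) = 1` iff `h` is
below the supremum of the `m` for which `b|_m = a|_m`. -/
def deltaObj (F : Hᵒᵖ ⥤ Type u) : RelSheaf H where
  of :=
    { carrier := ⟨Elts F⟩
      e := (InfPT.ofMatrix fun b a => agree F b a : InfPT H (Elts F) (Elts F))
      symm := InfPT.ext_val fun b a => by
        show InfPT.val (InfPT.inv _) b a = _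
        rw [InfPT.val_inv, InfPT.val_ofMatrix, InfPT.val_ofMatrix, agree_symm]
      idem := by
        have h := deltaPT_comp (𝟙 F) (𝟙 F)
        rw [Category.comp_id] at h
        simp only [deltaPT, eltsMap_id] at h
        exact h }

theorem deltaObj_e (F : Hᵒᵖ ⥤ Type u) : (deltaObj F).of.e = deltaPT (𝟙 F) := by
  simp only [deltaObj, deltaPT, eltsMap_id]

/-- The morphism `Δ_inf(τ)` of relational-sheaves. -/
def deltaMap {F G : Hᵒᵖ ⥤ Type u} (τ : F ⟶ G) : deltaObj F ⟶ deltaObj G where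
  f :=
    { φ := deltaPT τ
      left := by
        rw [deltaObj_e]
        exact (deltaPT_comp _ _).trans (by rw [Category.id_comp])
      right := by
        rw [deltaObj_e]
        exact (deltaPT_comp _ _).trans (by rw [Category.comp_id]) }
  total := by
    show (InfPT.ofMatrix fun b a => agree F b a) ≤ (deltaPT τ).comp (deltaPT τ).inv
    refine InfPT.le_iff.2 fun c a => ?_
    simp only [InfPT.val_comp, InfPT.val_inv, deltaPT, InfPT.val_ofMatrix]
    refine le_trans (le_inf ?_ ?_)
      (le_iSup (fun b => agree G b (eltsMap τ c) ⊓ agree G b (eltsMap τ a)) (eltsMap τ a))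
    · rw [agree_symm F c a]
      exact agree_map τ a c
    · rw [agree_self]
      exact agree_le_right F c a
  single := by
    show (deltaPT τ).inv.comp (deltaPT τ) ≤ (InfPT.ofMatrix fun b a => agree G b a)
    refine InfPT.le_iff.2 fun c b => ?_
    simp only [InfPT.val_comp, InfPT.val_inv, deltaPT, InfPT.val_ofMatrix]
    refine iSup_le fun a => ?_
    rw [agree_symm G b]
    exact agree_trans G _ _ _

variable (H) in
/-- The functor `Δ_inf : Set^{H^op} ⥤ Rel^{H^co}_inf`. -/
def DeltaInf : (Hᵒᵖ ⥤ Type u) ⥤ RelSheaf H where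
  obj := deltaObj
  map := deltaMap
  map_id F := MapStar.Hom.ext (KarStar.Hom.ext (deltaObj_e F).symm)
  map_comp τ σ := MapStar.Hom.ext (KarStar.Hom.ext (deltaPT_comp τ σ).symm)

end Delta

/-! ### Singletons and the functor `Θ_inf` -/

section Theta

variable {H : Type u} [Order.Frame H]

theorem iSup_punit (f : PUnit.{u + 1} → H) : ⨆ x, f x = f PUnit.unit :=
  le_antisymm (iSup_le fun _ => le_rfl) (le_iSup f PUnit.unit)

/-- The family of relations on a one-point set whose `k`-th relation is `1` iff `k ≤ h`. -/
def pointPT (h : H) : InfPT H PUnit.{u + 1} PUnit.{u + 1} := InfPT.ofMatrix fun _ _ => h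

theorem pointPT_comp (h k : H) : (pointPT h).comp (pointPT k) = pointPT (h ⊓ k) :=
  InfPT.ext_val fun _ _ => by
    simp only [pointPT, InfPT.val_comp, InfPT.val_ofMatrix]
    rw [iSup_punit, inf_comm]

theorem pointPT_inv (h : H) : (pointPT h).inv = pointPT h := rfl

theorem pointPT_mono {h k : H} (hk : h ≤ k) : pointPT h ≤ pointPT k :=
  InfPT.le_iff.2 fun _ _ => by simpa only [pointPT, InfPT.val_ofMatrix] using hk

theorem pointPT_idem (h : H) : (pointPT h).comp (pointPT h) = pointPT h := by
  rw [pointPT_comp, inf_idem]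

/-- The singleton `F_h`: a one-point set, with `F_h(k)(*, *) = 1` iff `k ≤ h`. -/
def singleton (h : H) : RelSheaf H where
  of :=
    { carrier := ⟨PUnit⟩
      e := pointPT h
      symm := pointPT_inv h
      idem := pointPT_idem h }

/-- The singleton morphism `F_h ⟶ F_k` for `h ≤ k`, with `l`-th relation `1` iff `l ≤ h`. -/
def singletonMap {h k : H} (hk : h ≤ k) : singleton h ⟶ singleton k where
  f :=
    { φ := pointPT h
      left := pointPT_idem h
      right := (pointPT_comp h k).trans (by rw [inf_eq_left.2 hk]) }
  total := (pointPT_idem h).ge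
  single := (pointPT_idem h).le.trans (pointPT_mono hk)

variable (H) in
/-- `h ↦ F_h` as a functor. -/
def singletonFunctor : H ⥤ RelSheaf H where
  obj := singleton
  map f := singletonMap (leOfHom f)
  map_id _ := rfl
  map_comp {h k l} f g := MapStar.Hom.ext (KarStar.Hom.ext
    ((pointPT_comp h k).trans (by rw [inf_eq_left.2 (leOfHom f)]; rfl)).symm)

variable (H) in
/-- The functor `Θ_inf : Rel^{H^co}_inf ⥤ Set^{H^op}`: `Θ_inf(F)(h)` is the set of singleton
morphisms `F_h ⟶ F`, restriction is precomposition with `F_k ⟶ F_h`, and `Θ_inf(τ)` is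
postcomposition with `τ`. -/
def ThetaInf : RelSheaf H ⥤ (Hᵒᵖ ⥤ Type u) where
  obj F := (singletonFunctor H).op ⋙ yoneda.obj F
  map τ := Functor.whiskerLeft (singletonFunctor H).op (yoneda.map τ)

/-- The element `α(x) = ⋁ {l | α_l(x, *) = 1}` of a singleton morphism `α`. -/
def sval {F : RelSheaf H} {h : H} (α : singleton h ⟶ F) (x : F.of.carrier.set) : H :=
  InfPT.val α.f.φ x PUnit.unit

/-- The matrix entries of a relational-sheaf. -/
def eval' (F : RelSheaf H) (x y : F.of.carrier.set) : H := InfPT.val F.of.e x y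

theorem sval_ext {F : RelSheaf H} {h : H} {α β : singleton h ⟶ F}
    (e : ∀ x, sval α x = sval β x) : α = β :=
  MapStar.Hom.ext (KarStar.Hom.ext (InfPT.ext_val fun x _ => e x))

theorem sval_right {F : RelSheaf H} {h : H} (α : singleton h ⟶ F) (x : F.of.carrier.set) :
    ⨆ y, eval' F x y ⊓ sval α y = sval α x :=
  (InfPT.val_comp α.f.φ F.of.e x PUnit.unit).symm.trans
    (congrArg (fun τ => InfPT.val τ x PUnit.unit) α.f.right)

theorem sval_le {F : RelSheaf H} {h : H} (α : singleton h ⟶ F) (x : F.of.carrier.set) :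
    sval α x ≤ h := by
  have h1 : ⨆ y : PUnit.{u + 1}, InfPT.val α.f.φ x y ⊓ (pointPT h).val y PUnit.unit = sval α x :=
    (InfPT.val_comp (pointPT h) α.f.φ x PUnit.unit).symm.trans
      (congrArg (fun τ => InfPT.val τ x PUnit.unit) α.f.left)
  rw [← h1]
  refine iSup_le fun _ => inf_le_right.trans ?_
  exact (InfPT.val_ofMatrix (fun _ _ => h) _ _).le

theorem sval_total {F : RelSheaf H} {h : H} (α : singleton h ⟶ F) : h ≤ ⨆ x, sval α x := by
  have h1 := InfPT.le_iff.1 (show pointPT h ≤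
    InfPT.comp (A := PUnit) (D := PUnit) α.f.φ (InfPT.inv α.f.φ) from α.total)
    PUnit.unit PUnit.unit
  have h2 := h1.trans (InfPT.val_comp (A := PUnit) (D := PUnit) α.f.φ (InfPT.inv α.f.φ)
    PUnit.unit PUnit.unit).le
  rw [pointPT, InfPT.val_ofMatrix] at h2
  exact h2.trans (iSup_mono fun x => inf_le_right)

theorem sval_single {F : RelSheaf H} {h : H} (α : singleton h ⟶ F) (x y : F.of.carrier.set) :
    sval α x ⊓ sval α y ≤ eval' F x y := by
  have h1 := InfPT.le_iff.1 (show InfPT.comp (InfPT.inv α.f.φ) α.f.φ ≤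
    F.of.e from α.single) x y
  rw [InfPT.val_comp] at h1
  exact (le_iSup (fun b : PUnit.{u + 1} => InfPT.val α.f.φ x b ⊓ InfPT.val α.f.φ y b)
    PUnit.unit).trans h1

theorem sval_res {F : RelSheaf H} {h k : H} (hk : k ≤ h) (α : singleton h ⟶ F)
    (x : F.of.carrier.set) : sval (singletonMap hk ≫ α) x = sval α x ⊓ k := by
  refine (InfPT.val_comp (pointPT k) α.f.φ x PUnit.unit).trans ?_
  refine (iSup_punit _).trans ?_
  rw [pointPT, InfPT.val_ofMatrix]
  rfl

/-- The family of relations from a one-point set to `X` given by `a : X → H`. -/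
def colPT {X : Type u} (a : X → H) : InfPT H PUnit.{u + 1} X := InfPT.ofMatrix fun x _ => a x

theorem colPT_left {X : Type u} (a : X → H) (h : H) (h2 : ∀ x, a x ≤ h) :
    (pointPT h).comp (colPT a) = colPT a :=
  InfPT.ext_val fun x _ => by
    simp only [pointPT, colPT, InfPT.val_comp, InfPT.val_ofMatrix]
    rw [iSup_punit, inf_eq_left.2 (h2 x)]

theorem colPT_right {X : Type u} (a : X → H) (e : InfPT H X X)
    (h1 : ∀ x, ⨆ y, e.val x y ⊓ a y = a x) : (colPT a).comp e = colPT a :=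
  InfPT.ext_val fun x _ => by
    simp only [colPT, InfPT.val_comp, InfPT.val_ofMatrix, h1]

theorem colPT_total {X : Type u} (a : X → H) (h : H) (h3 : h ≤ ⨆ x, a x) :
    pointPT h ≤ (colPT a).comp (colPT a).inv :=
  InfPT.le_iff.2 fun _ _ => by
    simpa only [pointPT, colPT, InfPT.val_comp, InfPT.val_inv, InfPT.val_ofMatrix, inf_idem]
      using h3

theorem colPT_single {X : Type u} (a : X → H) (e : InfPT H X X)
    (h4 : ∀ x y, a x ⊓ a y ≤ e.val x y) : (colPT a).inv.comp (colPT a) ≤ e :=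
  InfPT.le_iff.2 fun x y => by
    simp only [colPT, InfPT.val_comp, InfPT.val_inv, InfPT.val_ofMatrix]
    exact iSup_le fun _ => h4 x y

/-- A singleton morphism from its values. -/
def mkSingleton (F : RelSheaf H) (h : H) (a : F.of.carrier.set → H)
    (h1 : ∀ x, ⨆ y, eval' F x y ⊓ a y = a x) (h2 : ∀ x, a x ≤ h) (h3 : h ≤ ⨆ x, a x)
    (h4 : ∀ x y, a x ⊓ a y ≤ eval' F x y) : singleton h ⟶ F where
  f :=
    { φ := colPT a
      left := colPT_left a h h2
      right := colPT_right a F.of.e h1 }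
  total := colPT_total a h h3
  single := colPT_single a F.of.e h4

theorem sval_mkSingleton (F : RelSheaf H) (h : H) (a : F.of.carrier.set → H) (h1 h2 h3 h4)
    (x : F.of.carrier.set) : sval (mkSingleton F h a h1 h2 h3 h4) x = a x :=
  InfPT.val_ofMatrix (fun x _ => a x) x PUnit.unit

theorem thetaInf_isShf (F : RelSheaf H) : IsShf ((ThetaInf H).obj F) := by
  intro A X
  let α : ∀ k : A, singleton k.1 ⟶ F := fun k => X.1 k
  have hα : ∀ (k l : A) (x : F.of.carrier.set),
      sval (α k) x ⊓ (k.1 ⊓ l.1) = sval (α l) x ⊓ (k.1 ⊓ l.1) := by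
    intro k l x
    have h := X.2 k l
    have h' : singletonMap (inf_le_left : k.1 ⊓ l.1 ≤ k.1) ≫ α k =
      singletonMap (inf_le_right : k.1 ⊓ l.1 ≤ l.1) ≫ α l := h
    rw [← sval_res inf_le_left, ← sval_res inf_le_right, h']
  have hα' : ∀ (k l : A) (x : F.of.carrier.set), sval (α l) x ⊓ k.1 ≤ sval (α k) x := by
    intro k l x
    refine le_trans (le_inf inf_le_left (le_inf inf_le_right
      (inf_le_left.trans (sval_le (α l) x)))) ?_
    rw [← hα k l x]
    exact inf_le_left
  let a : F.of.carrier.set → H := fun x => ⨆ k : A, sval (α k) x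
  have h1 : ∀ x, ⨆ y, eval' F x y ⊓ a y = a x := by
    intro x
    simp only [a, inf_iSup_eq]
    rw [iSup_comm]
    exact iSup_congr fun k => sval_right (α k) x
  have h2 : ∀ x, a x ≤ sSup A := fun x =>
    iSup_le fun k => (sval_le (α k) x).trans (le_sSup k.2)
  have h3 : sSup A ≤ ⨆ x, a x := sSup_le fun k hk =>
    (sval_total (α ⟨k, hk⟩)).trans (iSup_mono fun x => le_iSup (fun k => sval (α k) x) ⟨k, hk⟩)
  have h4 : ∀ x y, a x ⊓ a y ≤ eval' F x y := by
    intro x y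
    simp only [a, inf_iSup_eq, iSup_inf_eq]
    refine iSup_le fun l => iSup_le fun k => ?_
    refine le_trans (le_inf ?_ inf_le_right) (sval_single (α l) x y)
    exact (inf_le_inf le_rfl (sval_le (α l) y)).trans (hα' l k x)
  refine ⟨mkSingleton F (sSup A) a h1 h2 h3 h4, fun k => ?_, fun β hβ => ?_⟩
  · show singletonMap (le_sSup k.2) ≫ mkSingleton F (sSup A) a h1 h2 h3 h4 = α k
    refine sval_ext fun x => ?_
    rw [sval_res, sval_mkSingleton]
    apply le_antisymm
    · simp only [a, iSup_inf_eq]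
      exact iSup_le fun l => hα' k l x
    · exact le_inf (le_iSup (fun k => sval (α k) x) k) (sval_le (α k) x)
  · let β' : singleton (sSup A) ⟶ F := β
    show β' = mkSingleton F (sSup A) a h1 h2 h3 h4
    refine sval_ext fun x => ?_
    rw [sval_mkSingleton]
    have hb : ∀ k : A, sval β' x ⊓ k.1 = sval (α k) x := by
      intro k
      rw [← sval_res (le_sSup k.2)]
      exact congrArg (fun γ => sval (F := F) (h := k.1) γ x) (hβ k)
    have : sval β' x = sval β' x ⊓ sSup A := (inf_eq_left.2 (sval_le β' x)).symm
    rw [this]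
    have h5 : sSup A = ⨆ k : A, k.1 := sSup_eq_iSup' A
    calc sval β' x ⊓ sSup A = sval β' x ⊓ ⨆ k : A, k.1 := congrArg (sval β' x ⊓ ·) h5
      _ = ⨆ k : A, sval β' x ⊓ k.1 := inf_iSup_eq _ _
      _ = a x := iSup_congr hb

end Theta

/-! ### The comparison functors -/

section Functors

variable (H : Type u) [Order.Frame H]

/-- `Δ_Shv : SHV(H) ⥤ Rel^{H^co}_inf`, the restriction of `Δ_inf` to sheaves. -/
def DeltaShv : SHV H ⥤ RelSheaf H := shvIncl H ⋙ DeltaInf H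

/-- `Θ_Shv : Rel^{H^co}_inf ⥤ SHV(H)`, the functor `Θ_inf` with values in sheaves. -/
def ThetaShv : RelSheaf H ⥤ SHV H := ObjectProperty.lift _ (ThetaInf H) thetaInf_isShf

/-- `Δ_Pre = Φ ∘ Δ_Shv ∘ Γ : Set^{H^op} ⥤ Rel^{H^co}_Ord`. -/
def DeltaPre : (Hᵒᵖ ⥤ Type u) ⥤ RelPresheaf H :=
  Gamma H ⋙ DeltaShv (LowerSet H) ⋙ Phi H

/-- `Θ_Pre = Λ ∘ Θ_Shv ∘ Ψ : Rel^{H^co}_Ord ⥤ Set^{H^op}`. -/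
def ThetaPre : RelPresheaf H ⥤ (Hᵒᵖ ⥤ Type u) :=
  Psi H ⋙ ThetaShv (LowerSet H) ⋙ Lambda H

/-- The associated sheaf functor `a_Shv = Θ_Shv ∘ Δ_inf`. -/
def aShv : (Hᵒᵖ ⥤ Type u) ⥤ SHV H := DeltaInf H ⋙ ThetaShv H

/-- The associated relational-sheaf functor `a_Rel = Δ_inf ∘ Θ_Pre`. -/
def aRel : RelPresheaf H ⥤ RelSheaf H := ThetaPre H ⋙ DeltaInf H

end Functors

end RelSh

namespace RelSh

/-! ### Idempotents with the same underlying arrow -/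

section KarIso

variable {C : Type w} [InvOrdSemicategory.{w, v} C]

/-! A relational-sheaf is a set with a symmetric idempotent `H`-valued matrix, and its morphisms are
`H`-valued matrices composed by `⨆` and `⊓`. Everything rests on the adjunction `Δ_inf ⊣ Θ_inf`,
whose counit is always invertible.

The counit is the evaluation matrix `(x, α) ↦ α(x)`, and its inverse is the transpose. One product
is right because the extent to which two singleton morphisms agree is `⨆ x, α(x) ⊓ β(x)`
(`agree_eq_iSup_sval`). The other is right because every element `y` gives a singleton morphism, its
own column of the matrix, so that no entry is lost (`iSup_sval_inf_sval`). The unit sends a section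
to its extents of agreement with all other sections. For a sheaf it is bijective, since the sections
lying under a singleton morphism match and glue (`sectionSingleton_bijective`). Hence sheaves and
relational-sheaves are equivalent.

Presheaves reduce to sheaves by replacing `H` with `DH`. The indices at which an order-preserving
family relates two elements form a down-set, that is, a single entry of a `DH`-valued matrix. A
sheaf on `DH` is determined by its values at principal down-sets, and a matching family on `h†` is
just its value at `h`. The remaining adjunctions are composites of `Δ_inf ⊣ Θ_inf` with these
equivalences. -/

theorem mapStar_hom_ext {X Y : MapStar (KarStar C)} {f g : X ⟶ Y} (h : f.f.φ = g.f.φ) : f = g :=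
  MapStar.Hom.ext (KarStar.Hom.ext h)

/-- Equal symmetric idempotents are isomorphic through themselves. -/
def karIsoOfEq {c : C} {e e' : InvOrdSemicategory.Hom c c} (h : e = e') (hs hi hs' hi') :
    (⟨⟨c, e, hs, hi⟩⟩ : MapStar (KarStar C)) ≅ ⟨⟨c, e', hs', hi'⟩⟩ :=
  eqToIso (by subst h; rfl)

/-- Identities of the Karoubi envelope are the idempotents themselves, so naturality of these
isomorphisms will reduce to the absorption laws of arrows. -/
theorem karIsoOfEq_hom {c : C} {e e' : InvOrdSemicategory.Hom c c} (h : e = e')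
    (hs hi hs' hi') : (karIsoOfEq h hs hi hs' hi').hom.f.φ = e := by
  subst h; rfl

end KarIso

/-! ### `Φ` and `Ψ` are mutually quasi-inverse -/

section PhiPsi

variable {H : Type u} [Order.Frame H]

/-- A down-set is the union of the principal ones it contains, so `X` lies below an entry of `τ` as
soon as every `h†` with `h ∈ X` does. -/
theorem psiSemi_phiSemi {A B : PTInf (LowerSet H)} (τ : InvOrdSemicategory.Hom A B) :
    (psiSemi H).map ((phiSemi H).map τ) = τ :=
  InfPT.ext (funext fun X => funext fun b => funext fun a => propext (by
    refine Iff.trans (forall₂_congr fun h _ => ?_) (InfPT.rel_iff τ X b a).symm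
    exact (InfPT.rel_iff τ (LowerSet.Iic h) b a).trans LowerSet.Iic_le))

theorem phiSemi_psiSemi {A B : PTOrd H} (τ : InvOrdSemicategory.Hom A B) :
    (phiSemi H).map ((psiSemi H).map τ) = τ :=
  OrdPT.ext_iff' fun h b a => by
    show (∀ k ∈ LowerSet.Iic h, OrdPT.rel τ k b a) ↔ OrdPT.rel τ h b a
    exact ⟨fun H' => H' h le_rfl, fun H' k hk => OrdPT.lower τ a b hk H'⟩

variable (H)

/-- `Ψ ∘ Φ` is isomorphic to the identity. -/
def phiPsiIso : 𝟭 (RelSheaf (LowerSet H)) ≅ Phi H ⋙ Psi H :=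
  NatIso.ofComponents
    (fun X => karIsoOfEq (psiSemi_phiSemi X.of.e).symm X.of.symm X.of.idem _ _)
    (fun {X Y} f => mapStar_hom_ext (by
      have hX := karIsoOfEq_hom (psiSemi_phiSemi X.of.e).symm X.of.symm X.of.idem
        ((Phi H ⋙ Psi H).obj X).of.symm ((Phi H ⋙ Psi H).obj X).of.idem
      have hY := karIsoOfEq_hom (psiSemi_phiSemi Y.of.e).symm Y.of.symm Y.of.idem
        ((Phi H ⋙ Psi H).obj Y).of.symm ((Phi H ⋙ Psi H).obj Y).of.idem
      exact (congrArg (InvOrdSemicategory.comp f.f.φ) hY).trans (f.f.right.trans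
        (f.f.left.symm.trans (congrArg₂ InvOrdSemicategory.comp hX.symm
          (psiSemi_phiSemi f.f.φ).symm)))))

/-- `Φ ∘ Ψ` is isomorphic to the identity. -/
def psiPhiIso : Psi H ⋙ Phi H ≅ 𝟭 (RelPresheaf H) :=
  Iso.symm (NatIso.ofComponents
    (fun X => karIsoOfEq (phiSemi_psiSemi X.of.e).symm X.of.symm X.of.idem _ _)
    (fun {X Y} f => mapStar_hom_ext (by
      have hX := karIsoOfEq_hom (phiSemi_psiSemi X.of.e).symm X.of.symm X.of.idem
        ((Psi H ⋙ Phi H).obj X).of.symm ((Psi H ⋙ Phi H).obj X).of.idem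
      have hY := karIsoOfEq_hom (phiSemi_psiSemi Y.of.e).symm Y.of.symm Y.of.idem
        ((Psi H ⋙ Phi H).obj Y).of.symm ((Psi H ⋙ Phi H).obj Y).of.idem
      exact (congrArg (InvOrdSemicategory.comp f.f.φ) hY).trans (f.f.right.trans
        (f.f.left.symm.trans (congrArg₂ InvOrdSemicategory.comp hX.symm
          (phiSemi_psiSemi f.f.φ).symm))))))

/-- Relational-sheaves on `DH` are equivalent to relational-presheaves on `H`. -/
def phiEquivalence : RelSheaf (LowerSet H) ≌ RelPresheaf H :=
  CategoryTheory.Equivalence.mk (Phi H) (Psi H) (phiPsiIso H) (psiPhiIso H)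

end PhiPsi

/-! ### `Γ` and `Λ` are mutually quasi-inverse -/

section GammaLambda

variable {H : Type u} [Order.Frame H]

/-- Gluing over a cover whose join is only propositionally equal to `h`, so that sections need not
be transported between fibres of `F`. -/
theorem IsShf.existsUnique_of_eq {F : Hᵒᵖ ⥤ Type u} (hF : IsShf F) {A : Set H} {h : H}
    (hA : sSup A = h) (X : MatchingFamily F A) :
    ∃! x : F.obj (op h), ∀ (k : A) (hk : k.1 ≤ h), res F hk x = X.1 k := by
  subst hA
  obtain ⟨x, hx, hu⟩ := hF A X
  exact ⟨x, fun k _ => hx k, fun y hy => hu y fun k => hy k _⟩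

theorem IsShf.eq_of_res_eq {F : Hᵒᵖ ⥤ Type u} (hF : IsShf F) {A : Set H} {h : H}
    (hA : sSup A = h) {x y : F.obj (op h)}
    (hxy : ∀ k ∈ A, ∀ hk : k ≤ h, res F hk x = res F hk y) : x = y := by
  have hle : ∀ k : A, k.1 ≤ h := fun k => hA ▸ le_sSup k.2
  let X : MatchingFamily F A := ⟨fun k => res F (hle k) y, fun k l => by rw [res_res, res_res]⟩
  exact (hF.existsUnique_of_eq hA X).unique (fun k hk => hxy k.1 k.2 hk) (fun k hk => rfl)

/-- The matching family on `h†` of the restrictions of `x ∈ F(h)`. -/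
def matchingOfElt (F : Hᵒᵖ ⥤ Type u) {h : H} (x : F.obj (op h)) :
    MatchingFamily F (LowerSet.Iic h : Set H) :=
  ⟨fun k => res F k.2 x, fun _ _ => (res_res F _ _ x).trans (res_res F _ _ x).symm⟩

/-- The down-set `h†` has greatest element `h`, so the value there determines the whole family. -/
theorem matchingOfElt_bijective (F : Hᵒᵖ ⥤ Type u) (h : H) :
    Function.Bijective (matchingOfElt F (h := h)) := by
  constructor
  · intro x y hxy
    have := congrFun (congrArg Subtype.val hxy) ⟨h, le_rfl⟩
    exact (res_self F x).symm.trans (this.trans (res_self F y))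
  · intro X
    refine ⟨X.1 ⟨h, le_rfl⟩, Subtype.ext (funext fun k => ?_)⟩
    exact X.res_eq k.2 _ k.2

variable (H) in
/-- The transformation `F(h) → ΛΓ(F)(h)`. -/
def gammaUnit : 𝟭 (Hᵒᵖ ⥤ Type u) ⟶ Gamma H ⋙ Lambda H where
  app F :=
    { app := fun h => ↾fun x => matchingOfElt F (h := h.unop) x
      naturality := fun h k f => by
        ext x
        refine Subtype.ext (funext fun m => ?_)
        exact res_res F (leOfHom f.unop) m.2 x }
  naturality F G τ := by
    ext h x
    refine Subtype.ext (funext fun m => ?_)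
    exact (app_res τ m.2 x).symm

instance (F : Hᵒᵖ ⥤ Type u) : IsIso ((gammaUnit H).app F) := by
  have : ∀ h, IsIso (((gammaUnit H).app F).app h) := fun h =>
    (isIso_iff_bijective _).2 (matchingOfElt_bijective F h.unop)
  exact NatIso.isIso_of_isIso_app _

instance : IsIso (gammaUnit H) := NatIso.isIso_of_isIso_app _

theorem sSup_image_Iic (A : LowerSet H) : sSup (LowerSet.Iic '' (A : Set H)) = A := by
  refine le_antisymm (sSup_le ?_) fun h hh => ?_
  · rintro _ ⟨k, hk, rfl⟩
    exact LowerSet.Iic_le.2 hk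
  · exact LowerSet.mem_sSup_iff.2 ⟨_, ⟨h, hh, rfl⟩, le_rfl⟩

theorem Iic_inf_le (k l : H) :
    (LowerSet.Iic k ⊓ LowerSet.Iic l : LowerSet H) ≤ LowerSet.Iic (k ⊓ l) :=
  fun _ hm => le_inf hm.1 hm.2

/-- The matching family on `A` of the restrictions of `x ∈ F(A)` to principal down-sets. -/
def matchingOfSection (F : SHV (LowerSet H)) {A : LowerSet H} (x : F.obj.obj (op A)) :
    MatchingFamily ((Lambda H).obj F) (A : Set H) :=
  ⟨fun k => res F.obj (LowerSet.Iic_le.2 k.2) x, fun _ _ =>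
    (res_res F.obj _ _ x).trans (res_res F.obj _ _ x).symm⟩

/-- This is the sheaf condition for the cover of `A` by the principal down-sets of its elements. -/
theorem matchingOfSection_bijective (F : SHV (LowerSet H)) (A : LowerSet H) :
    Function.Bijective (matchingOfSection F (A := A)) := by
  constructor
  · intro x y hxy
    refine F.property.eq_of_res_eq (sSup_image_Iic A) ?_
    rintro _ ⟨k, hk, rfl⟩ _
    exact congrFun (congrArg Subtype.val hxy) ⟨k, hk⟩
  · intro X
    have mem : ∀ B : (LowerSet.Iic '' (A : Set H)), ∃ k : A, LowerSet.Iic k.1 = B.1 := by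
      rintro ⟨_, k, hk, rfl⟩
      exact ⟨⟨k, hk⟩, rfl⟩
    choose k hk using mem
    -- Compatibility is given only on `(k ⊓ l)†`, but every `B` below both `k†` and `l†` is
    -- contained in it. This also makes the chosen generators `k B` harmless.
    have key : ∀ (k l : A) (B : LowerSet H) (h1 : B ≤ LowerSet.Iic k.1)
        (h2 : B ≤ LowerSet.Iic l.1), res F.obj h1 (X.1 k) = res F.obj h2 (X.1 l) := by
      intro k l B h1 h2
      have h3 : B ≤ LowerSet.Iic (k.1 ⊓ l.1) := (le_inf h1 h2).trans (Iic_inf_le _ _)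
      have h4 := congrArg (res F.obj h3) (X.2 k l)
      exact (res_res F.obj _ h3 _).symm.trans (h4.trans (res_res F.obj _ h3 _))
    let Y : MatchingFamily F.obj (LowerSet.Iic '' (A : Set H)) :=
      ⟨fun B => res F.obj (hk B).ge (X.1 (k B)), fun B C =>
        (res_res F.obj _ _ _).trans ((key _ _ _ _ _).trans (res_res F.obj _ _ _).symm)⟩
    obtain ⟨x, hx, -⟩ := F.property.existsUnique_of_eq (sSup_image_Iic A) Y
    refine ⟨x, Subtype.ext (funext fun l => ?_)⟩
    refine (hx ⟨_, l.1, l.2, rfl⟩ (LowerSet.Iic_le.2 l.2)).trans ?_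
    exact (key _ l _ _ le_rfl).trans (res_self F.obj (X.1 l))

variable (H) in
/-- The transformation `F(A) → ΓΛ(F)(A)`. -/
def lambdaCounitInv : 𝟭 (SHV (LowerSet H)) ⟶ Lambda H ⋙ Gamma H where
  app F := ObjectProperty.homMk
    { app := fun A => ↾fun x => matchingOfSection F (A := A.unop) x
      naturality := fun A B f => by
        ext x
        refine Subtype.ext (funext fun m => ?_)
        exact res_res F.obj (leOfHom f.unop) (LowerSet.Iic_le.2 m.2) x }
  naturality F G τ := by
    ext A x
    refine Subtype.ext (funext fun m => ?_)
    exact (app_res τ.hom (LowerSet.Iic_le.2 m.2) x).symm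

instance (F : SHV (LowerSet H)) : IsIso ((lambdaCounitInv H).app F) := by
  have : ∀ A, IsIso (((shvIncl (LowerSet H)).map ((lambdaCounitInv H).app F)).app A) := fun A =>
    (isIso_iff_bijective _).2 (matchingOfSection_bijective F A.unop)
  have : IsIso ((shvIncl (LowerSet H)).map ((lambdaCounitInv H).app F)) :=
    NatIso.isIso_of_isIso_app _
  exact isIso_of_reflects_iso _ (shvIncl (LowerSet H))

instance : IsIso (lambdaCounitInv H) := NatIso.isIso_of_isIso_app _

variable (H) in
/-- Presheaves on `H` are equivalent to sheaves on `DH`. -/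
noncomputable def gammaEquivalence : (Hᵒᵖ ⥤ Type u) ≌ SHV (LowerSet H) :=
  CategoryTheory.Equivalence.mk (Gamma H) (Lambda H) (asIso (gammaUnit H)) (asIso (lambdaCounitInv H)).symm

end GammaLambda

/-! ### The adjunction `Δ_inf ⊣ Θ_inf` -/

section DeltaTheta

variable {H : Type u} [Order.Frame H]

theorem sval_comp {F G : RelSheaf H} {h : H} (α : singleton h ⟶ F) (f : F ⟶ G)
    (y : G.of.carrier.set) :
    sval (α ≫ f) y = ⨆ x, InfPT.val f.f.φ y x ⊓ sval α x :=
  InfPT.val_comp α.f.φ f.f.φ y PUnit.unit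

theorem eval'_inf_sval_le {F : RelSheaf H} {h : H} (α : singleton h ⟶ F)
    (x y : F.of.carrier.set) : eval' F x y ⊓ sval α y ≤ sval α x :=
  (le_iSup (fun y => eval' F x y ⊓ sval α y) y).trans (sval_right α x).le

theorem eval'_deltaObj (F : Hᵒᵖ ⥤ Type u) (b a : Elts F) :
    eval' (deltaObj F) b a = agree F b a := InfPT.val_ofMatrix _ b a

theorem eval'_symm (F : RelSheaf H) (x y : F.of.carrier.set) : eval' F x y = eval' F y x :=
  congrArg (fun τ => InfPT.val τ y x) F.of.symm

theorem eval'_idem (F : RelSheaf H) (x z : F.of.carrier.set) :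
    ⨆ y, eval' F x y ⊓ eval' F y z = eval' F x z :=
  (InfPT.val_comp F.of.e F.of.e x z).symm.trans
    (congrArg (fun τ => InfPT.val τ x z) F.of.idem)

theorem eval'_trans (F : RelSheaf H) (x y z : F.of.carrier.set) :
    eval' F x y ⊓ eval' F y z ≤ eval' F x z :=
  (le_iSup (fun y => eval' F x y ⊓ eval' F y z) y).trans (eval'_idem F x z).le

theorem eval'_le_right (F : RelSheaf H) (x y : F.of.carrier.set) :
    eval' F x y ≤ eval' F y y :=
  (le_inf (eval'_symm F x y).le le_rfl).trans (eval'_trans F y x y)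

/-- The singleton morphism `y ↦ F(y, x)` of an element of a relational-sheaf. -/
def eltSingleton (F : RelSheaf H) (x : F.of.carrier.set) : singleton (eval' F x x) ⟶ F :=
  mkSingleton F _ (fun y => eval' F y x) (fun y => eval'_idem F y x)
    (fun y => eval'_le_right F y x) (le_iSup (fun y => eval' F y x) x)
    (fun y z => by rw [eval'_symm F z x]; exact eval'_trans F y x z)

theorem sval_eltSingleton (F : RelSheaf H) (x y : F.of.carrier.set) :
    sval (eltSingleton F x) y = eval' F y x := sval_mkSingleton ..

/-- The singleton morphism `y ↦ ⋁ {m | y|_m = x|_m}` of an element of a presheaf. -/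
def sectionSingleton (F : Hᵒᵖ ⥤ Type u) {h : H} (x : F.obj (op h)) :
    singleton h ⟶ deltaObj F :=
  mkSingleton (deltaObj F) h (fun y => agree F y ⟨h, x⟩)
    (fun y => (iSup_congr fun z => congrArg (_ ⊓ ·) (eval'_deltaObj F z ⟨h, x⟩).symm).trans
      ((eval'_idem (deltaObj F) y ⟨h, x⟩).trans (eval'_deltaObj F y ⟨h, x⟩)))
    (fun y => agree_le_right F y ⟨h, x⟩)
    ((agree_self F ⟨h, x⟩).ge.trans (le_iSup (fun y : Elts F => agree F y ⟨h, x⟩) ⟨h, x⟩))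
    (fun y z => (inf_le_inf le_rfl (agree_symm F z _).le).trans
      ((agree_trans F y _ z).trans (eval'_deltaObj F y z).ge))

theorem sval_sectionSingleton (F : Hᵒᵖ ⥤ Type u) {h : H} (x : F.obj (op h)) (y : Elts F) :
    sval (sectionSingleton F x) y = agree F y ⟨h, x⟩ := sval_mkSingleton ..

theorem agree_res (F : Hᵒᵖ ⥤ Type u) {h k : H} (hk : k ≤ h) (x : F.obj (op h)) (y : Elts F) :
    agree F y ⟨k, res F hk x⟩ = agree F y ⟨h, x⟩ ⊓ k := by
  apply le_antisymm
  · refine sSup_le fun m ⟨h1, h2, e⟩ => le_inf (le_sSup ⟨h1, h2.trans hk, ?_⟩) h2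
    rw [e, res_res]
  · unfold agree
    rw [sSup_inf_eq]
    refine iSup₂_le fun m ⟨h1, h2, e⟩ => le_sSup ⟨inf_le_left.trans h1, inf_le_right, ?_⟩
    rw [← res_res F h1 inf_le_left, e, res_res, res_res]

/-- The join is attained at `y = a`, where `agree F a a` is the full extent of `a`. -/
theorem iSup_agree_eltsMap {F G : Hᵒᵖ ⥤ Type u} (τ : F ⟶ G) (b : Elts G) (a : Elts F) :
    ⨆ y, agree G b (eltsMap τ y) ⊓ agree F y a = agree G b (eltsMap τ a) := by
  apply le_antisymm
  · exact iSup_le fun y => (inf_le_inf le_rfl (agree_map τ y a)).trans (agree_trans G _ _ _)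
  · refine le_trans (le_inf le_rfl ?_)
      (le_iSup (fun y => agree G b (eltsMap τ y) ⊓ agree F y a) a)
    rw [agree_self]
    exact agree_le_right G _ _

theorem sectionSingleton_comp {F G : Hᵒᵖ ⥤ Type u} (τ : F ⟶ G) {h : H} (x : F.obj (op h)) :
    sectionSingleton F x ≫ deltaMap τ = sectionSingleton G (τ.app (op h) x) :=
  sval_ext fun b => (sval_comp _ _ b).trans
    ((iSup_congr fun y => congrArg₂ _ (InfPT.val_ofMatrix _ b y)
      (sval_sectionSingleton F x y)).trans
      ((iSup_agree_eltsMap τ b ⟨h, x⟩).trans (sval_sectionSingleton G _ b).symm))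

variable (H) in
/-- The unit of `Δ_inf ⊣ Θ_inf`. -/
def deltaThetaUnit : 𝟭 (Hᵒᵖ ⥤ Type u) ⟶ DeltaInf H ⋙ ThetaInf H where
  app F :=
    { app := fun h => ↾fun x => sectionSingleton F (h := h.unop) x
      naturality := fun h k f => by
        ext x
        refine sval_ext (F := deltaObj F) (h := k.unop) fun y => ?_
        refine (sval_sectionSingleton F _ y).trans ((agree_res F (leOfHom f.unop) x y).trans ?_)
        exact Eq.trans (congrArg (· ⊓ _) (sval_sectionSingleton F x y).symm)
          (sval_res (leOfHom f.unop) (sectionSingleton F x) y).symm }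
  naturality F G τ := by
    ext h x
    exact (sectionSingleton_comp τ x).symm

/-! ### The evaluation matrix and its inverse -/

/-- The values of an element of `Θ_inf(F)`. -/
def thetaVal (F : RelSheaf H) (α : Elts ((ThetaInf H).obj F)) (x : F.of.carrier.set) : H :=
  sval (F := F) (h := α.1) α.2 x

theorem thetaVal_le (F : RelSheaf H) (α : Elts ((ThetaInf H).obj F)) (x : F.of.carrier.set) :
    thetaVal F α x ≤ α.1 := sval_le (F := F) (h := α.1) α.2 x

theorem sval_res_thetaInf (F : RelSheaf H) (α : Elts ((ThetaInf H).obj F)) {m : H}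
    (hm : m ≤ α.1) (x : F.of.carrier.set) :
    sval (F := F) (h := m) (res ((ThetaInf H).obj F) hm α.2) x = thetaVal F α x ⊓ m :=
  sval_res (F := F) hm (α.2 : singleton α.1 ⟶ F) x

theorem sval_inf_agree_le (F : RelSheaf H) (β α : Elts ((ThetaInf H).obj F))
    (x : F.of.carrier.set) :
    thetaVal F β x ⊓ agree _ β α ≤ thetaVal F α x := by
  unfold agree
  rw [inf_sSup_eq]
  refine iSup₂_le fun m ⟨h1, h2, e⟩ => ?_
  have h3 := congrArg (fun γ => sval (F := F) (h := m) γ x) e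
  rw [sval_res_thetaInf, sval_res_thetaInf] at h3
  rw [h3]
  exact inf_le_left

/-- A Yoneda-type identity: the join is attained at `β = α`. It supplies the left absorption law of
`evalPT`, naturality of the counit and both triangle identities. -/
theorem iSup_sval_inf_agree (F : RelSheaf H) (α : Elts ((ThetaInf H).obj F))
    (x : F.of.carrier.set) :
    ⨆ β : Elts ((ThetaInf H).obj F), thetaVal F β x ⊓ agree _ β α =
      thetaVal F α x := by
  apply le_antisymm (iSup_le fun β => sval_inf_agree_le F β α x)
  refine le_trans (le_inf le_rfl ?_) (le_iSup (fun β : Elts ((ThetaInf H).obj F) =>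
    thetaVal F β x ⊓ agree _ β α) α)
  rw [agree_self]
  exact thetaVal_le F α x

theorem agree_eq_iSup_sval (F : RelSheaf H) (α β : Elts ((ThetaInf H).obj F)) :
    agree _ α β = ⨆ x, thetaVal F α x ⊓ thetaVal F β x := by
  apply le_antisymm
  -- Where the restrictions to `m` coincide, totality of the common restriction covers `m` by its
  -- values, which lie below those of both `α` and `β`.
  · refine sSup_le fun m ⟨h1, h2, e⟩ => ?_
    refine (sval_total (singletonMap h1 ≫ (α.2 : singleton α.1 ⟶ F))).trans
      (iSup_mono fun x => le_inf ?_ ?_)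
    · exact (sval_res_thetaInf F α h1 x).le.trans inf_le_left
    · have h3 := congrArg (fun γ => sval (F := F) (h := m) γ x) e
      exact h3.le.trans ((sval_res_thetaInf F β h2 x).le.trans inf_le_left)
  · have aux : ∀ (γ δ : Elts ((ThetaInf H).obj F)) (y : F.of.carrier.set),
        thetaVal F γ y ⊓ ⨆ x, thetaVal F γ x ⊓ thetaVal F δ x ≤ thetaVal F δ y := by
      intro γ δ y
      rw [inf_iSup_eq]
      refine iSup_le fun x => ?_
      rw [← inf_assoc]
      exact (inf_le_inf (sval_single (F := F) (h := γ.1) γ.2 y x) le_rfl).trans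
        (eval'_inf_sval_le (F := F) (h := δ.1) δ.2 y x)
    refine le_sSup ⟨iSup_le fun x => inf_le_left.trans (thetaVal_le F α x),
      iSup_le fun x => inf_le_right.trans (thetaVal_le F β x), ?_⟩
    refine sval_ext (F := F) fun y => ?_
    rw [sval_res_thetaInf, sval_res_thetaInf]
    refine le_antisymm (le_inf (aux α β y) inf_le_right) (le_inf ?_ inf_le_right)
    simp only [inf_comm (thetaVal F α _)]
    exact aux β α y

/-- The singleton morphism of `y` alone attains the bound: its values at `x` and `y` are the entries
at `(x, y)` and `(y, y)`, and the second dominates the first. -/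
theorem iSup_sval_inf_sval (F : RelSheaf H) (x y : F.of.carrier.set) :
    ⨆ α : Elts ((ThetaInf H).obj F),
      thetaVal F α x ⊓ thetaVal F α y = eval' F x y := by
  refine le_antisymm (iSup_le fun α => sval_single (F := F) (h := α.1) α.2 x y) ?_
  refine le_trans (le_inf ?_ ?_) (le_iSup (fun α : Elts ((ThetaInf H).obj F) =>
    thetaVal F α x ⊓ thetaVal F α y)
    ⟨eval' F y y, eltSingleton F y⟩)
  · exact (sval_eltSingleton F y x).ge
  · exact (eval'_le_right F x y).trans (sval_eltSingleton F y y).ge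

/-- The evaluation matrix `(x, α) ↦ α(x)`. -/
def evalPT (F : RelSheaf H) : InfPT H (Elts ((ThetaInf H).obj F)) F.of.carrier.set :=
  InfPT.ofMatrix fun x α => thetaVal F α x

theorem val_evalPT (F : RelSheaf H) (x : F.of.carrier.set) (α : Elts ((ThetaInf H).obj F)) :
    (evalPT F).val x α = thetaVal F α x := InfPT.val_ofMatrix _ x α

theorem evalPT_left (F : RelSheaf H) :
    InfPT.comp (deltaObj ((ThetaInf H).obj F)).of.e (evalPT F) = evalPT F :=
  InfPT.ext_val fun x α => (InfPT.val_comp _ _ x α).trans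
    ((iSup_congr fun β => congrArg₂ _ (val_evalPT F x β) (eval'_deltaObj _ β α)).trans
      ((iSup_sval_inf_agree F α x).trans (val_evalPT F x α).symm))

theorem evalPT_right (F : RelSheaf H) : (evalPT F).comp F.of.e = evalPT F :=
  InfPT.ext_val fun x α => by
    rw [InfPT.val_comp, val_evalPT]
    exact (iSup_congr fun y => congrArg (_ ⊓ ·) (val_evalPT F y α)).trans
      (sval_right (F := F) (h := α.1) α.2 x)

theorem evalPT_comp_inv (F : RelSheaf H) :
    (evalPT F).comp (evalPT F).inv = (deltaObj ((ThetaInf H).obj F)).of.e :=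
  InfPT.ext_val fun α β => by
    rw [InfPT.val_comp]
    refine Eq.trans ?_ ((agree_eq_iSup_sval F α β).symm.trans (eval'_deltaObj _ α β).symm)
    exact iSup_congr fun x => congrArg₂ _ (val_evalPT F x α) (val_evalPT F x β)

theorem evalPT_inv_comp (F : RelSheaf H) : (evalPT F).inv.comp (evalPT F) = F.of.e :=
  InfPT.ext_val fun x y => by
    rw [InfPT.val_comp]
    refine Eq.trans ?_ (iSup_sval_inf_sval F x y)
    exact iSup_congr fun α => congrArg₂ _ (val_evalPT F x α) (val_evalPT F y α)

/-- Evaluation of singleton morphisms is an isomorphism `Δ_inf Θ_inf F ≅ F`. -/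
def evalIso (F : RelSheaf H) : deltaObj ((ThetaInf H).obj F) ≅ F where
  hom :=
    { f := { φ := evalPT F, left := evalPT_left F, right := evalPT_right F }
      total := (evalPT_comp_inv F).ge
      single := (evalPT_inv_comp F).le }
  inv :=
    { f := InvOrdCategory.star (O := KarStar (PTInf H))
        { φ := evalPT F, left := evalPT_left F, right := evalPT_right F }
      total := (evalPT_inv_comp F).ge
      single := (evalPT_comp_inv F).le }
  hom_inv_id := mapStar_hom_ext (evalPT_comp_inv F)
  inv_hom_id := mapStar_hom_ext (evalPT_inv_comp F)

variable (H) in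
/-- The counit of `Δ_inf ⊣ Θ_inf` is an isomorphism. -/
def deltaThetaCounit : ThetaInf H ⋙ DeltaInf H ≅ 𝟭 (RelSheaf H) :=
  NatIso.ofComponents evalIso fun {F G} f => mapStar_hom_ext (by
    show InfPT.comp (deltaPT ((ThetaInf H).map f)) (evalPT G) = InfPT.comp (evalPT F) f.f.φ
    refine InfPT.ext_val fun y α => ?_
    rw [InfPT.val_comp, InfPT.val_comp]
    have h1 := iSup_sval_inf_agree G (eltsMap ((ThetaInf H).map f) α) y
    have h2 := sval_comp (α.2 : singleton α.1 ⟶ F) f y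
    refine Eq.trans (iSup_congr fun β => ?_) (h1.trans (h2.trans (iSup_congr fun x => ?_)))
    · exact congrArg₂ _ (val_evalPT G y β) (InfPT.val_ofMatrix _ β α)
    · exact congrArg (_ ⊓ ·) (val_evalPT F x α).symm)

/-! ### Triangle identities -/

theorem deltaPT_unit_comp_evalPT (F : Hᵒᵖ ⥤ Type u) :
    (deltaPT ((deltaThetaUnit H).app F)).comp (evalPT (deltaObj F)) = (deltaObj F).of.e :=
  InfPT.ext_val fun y a => (InfPT.val_comp _ _ y a).trans
    ((iSup_congr fun β => congrArg₂ _ (val_evalPT (deltaObj F) y β)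
      (InfPT.val_ofMatrix _ β a)).trans
      ((iSup_sval_inf_agree (deltaObj F) (eltsMap ((deltaThetaUnit H).app F) a) y).trans
        ((sval_sectionSingleton F a.2 y).trans (eval'_deltaObj F y a).symm)))

theorem sectionSingleton_comp_evalIso (F : RelSheaf H) {h : H} (α : singleton h ⟶ F) :
    sectionSingleton ((ThetaInf H).obj F) (h := h) α ≫ (evalIso F).hom = α :=
  sval_ext fun x => (sval_comp _ _ x).trans
    ((iSup_congr fun β => congrArg₂ _ (val_evalPT F x β) (sval_sectionSingleton _ _ β)).trans
      (iSup_sval_inf_agree F ⟨h, α⟩ x))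

variable (H) in
/-- The adjunction `Δ_inf ⊣ Θ_inf`. -/
def deltaThetaAdj : DeltaInf H ⊣ ThetaInf H where
  unit := deltaThetaUnit H
  counit := (deltaThetaCounit H).hom
  left_triangle_components F := mapStar_hom_ext (deltaPT_unit_comp_evalPT F)
  right_triangle_components F := by
    ext h α
    exact sectionSingleton_comp_evalIso F α

/-- A singleton morphism to `Δ_inf F` for a sheaf `F` comes from a unique section. -/
theorem sectionSingleton_bijective {F : Hᵒᵖ ⥤ Type u} (hF : IsShf F) (h : H) :
    Function.Bijective (sectionSingleton F (h := h)) := by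
  -- Separatedness: if `m` lies below the extent of agreement, then the indices below `m` at which
  -- the two sections coincide cover `m`.
  have sep : ∀ {m : H} {k l : Elts F} (h1 : m ≤ k.1) (h2 : m ≤ l.1), m ≤ agree F k l →
      res F h1 k.2 = res F h2 l.2 := by
    intro m k l h1 h2 hm
    refine hF.eq_of_res_eq (A := {n | n ≤ m ∧ ∃ (hb : n ≤ k.1) (ha : n ≤ l.1),
      res F hb k.2 = res F ha l.2}) ?_ ?_
    · refine le_antisymm (sSup_le fun n hn => hn.1) ?_
      refine (le_inf le_rfl hm).trans ?_
      unfold agree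
      rw [inf_sSup_eq]
      refine iSup₂_le fun n ⟨h3, h4, e⟩ => le_sSup ⟨inf_le_left, inf_le_right.trans h3,
        inf_le_right.trans h4, ?_⟩
      rw [← res_res F h3 inf_le_right, e, res_res]
    · rintro n ⟨hn, _, _, e⟩ _
      rw [res_res, res_res, e]
  constructor
  · intro x y hxy
    -- Evaluating at `x` itself turns the equality into agreement of `x` and `y` on all of `h`.
    have h1 := congrArg (fun γ => sval γ (⟨h, x⟩ : Elts F)) hxy
    simp only [sval_sectionSingleton] at h1
    rw [agree_self] at h1
    have h2 := sep (k := ⟨h, x⟩) (l := ⟨h, y⟩) (le_refl h) (le_refl h) h1.le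
    rwa [res_self, res_self] at h2
  · intro α
    have single : ∀ y z : Elts F, sval α y ⊓ sval α z ≤ agree F y z := fun y z =>
      (sval_single α y z).trans (eval'_deltaObj F y z).le
    have trans : ∀ y z : Elts F, agree F y z ⊓ sval α z ≤ sval α y := fun y z =>
      (inf_le_inf (eval'_deltaObj F y z).ge le_rfl).trans (eval'_inf_sval_le α y z)
    -- The cover of `h` by extents of sections on which `α` takes its largest possible value. Any
    -- `y` contributes its restriction to `α(y)`, so totality of `α` gives join `h`;
    -- single-valuedness makes any choice of such sections match.
    let A : Set H := {m | ∃ x : F.obj (op m), m ≤ sval α (⟨m, x⟩ : Elts F)}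
    choose s hs using fun m : A => m.2
    have hA : sSup A = h := by
      refine le_antisymm (sSup_le fun m ⟨x, hx⟩ => hx.trans (sval_le α _)) ?_
      refine (sval_total α).trans (iSup_le fun y : Elts F => le_sSup ?_)
      have hy : sval α y ≤ y.1 :=
        (le_inf le_rfl le_rfl).trans ((single y y).trans (agree_self F y).le)
      refine ⟨res F hy y.2, le_trans (le_inf ?_ le_rfl) (trans ⟨_, res F hy y.2⟩ y)⟩
      exact le_sSup ⟨le_rfl, hy, res_self F _⟩
    obtain ⟨x, hx, -⟩ := hF.existsUnique_of_eq hA ⟨s, fun k l =>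
      sep (k := ⟨k.1, s k⟩) (l := ⟨l.1, s l⟩) inf_le_left inf_le_right
        ((inf_le_inf (hs k) (hs l)).trans (single _ _))⟩
    -- The glued section agrees on each `m` with the chosen one there, where `α` is at least `m`;
    -- hence `α` is full at `x`, which forces `α(y)` to equal the agreement of `y` with `x`.
    have hxα : h ≤ sval α (⟨h, x⟩ : Elts F) := by
      conv_lhs => rw [← hA]
      refine sSup_le fun m hm => ?_
      have hmh : m ≤ h := hA ▸ le_sSup hm
      refine le_trans (le_inf ?_ (hs ⟨m, hm⟩)) (trans ⟨h, x⟩ ⟨m, s ⟨m, hm⟩⟩)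
      exact le_sSup ⟨hmh, le_rfl, (hx ⟨m, hm⟩ hmh).trans (res_self F _).symm⟩
    refine ⟨x, sval_ext fun y : Elts F => ?_⟩
    rw [sval_sectionSingleton]
    apply le_antisymm
    · exact (le_inf le_rfl ((agree_le_right F y _).trans hxα)).trans (trans y ⟨h, x⟩)
    · exact (le_inf le_rfl ((sval_le α y).trans hxα)).trans (single y ⟨h, x⟩)

theorem isIso_deltaThetaUnit_app {F : Hᵒᵖ ⥤ Type u} (hF : IsShf F) :
    IsIso ((deltaThetaUnit H).app F) := by
  have : ∀ h, IsIso (((deltaThetaUnit H).app F).app h) := fun h =>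
    (isIso_iff_bijective _).2 (sectionSingleton_bijective hF h.unop)
  exact NatIso.isIso_of_isIso_app _

variable (H) in
/-- On sheaves, `Θ_inf ∘ Δ_inf` is isomorphic to the inclusion. -/
noncomputable def shvInclIso : shvIncl H ≅ DeltaShv H ⋙ ThetaInf H :=
  haveI : ∀ F : SHV H, IsIso ((Functor.whiskerLeft (shvIncl H) (deltaThetaUnit H)).app F) :=
    fun F => isIso_deltaThetaUnit_app F.property
  haveI : IsIso (Functor.whiskerLeft (shvIncl H) (deltaThetaUnit H)) :=
    NatIso.isIso_of_isIso_app _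
  -- This has the required type only up to unfolding `DeltaShv` and the composite with the identity.
  let e : shvIncl H ⋙ 𝟭 _ ≅ shvIncl H ⋙ DeltaInf H ⋙ ThetaInf H :=
    asIso (Functor.whiskerLeft (shvIncl H) (deltaThetaUnit H))
  e

variable (H) in
/-- Sheaves are equivalent to relational-sheaves. -/
noncomputable def deltaShvEquivalence : SHV H ≌ RelSheaf H :=
  CategoryTheory.Equivalence.mk (DeltaShv H) (ThetaShv H)
    -- The unit is an isomorphism of underlying presheaves, lifted to sheaves by full faithfulness
    -- of the inclusion.
    (((ObjectProperty.fullyFaithfulι _).whiskeringRight _).preimageIso (shvInclIso H))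
    (deltaThetaCounit H)

end DeltaTheta

end RelSh

theorem mainTheorem2 (H : Type u) [Order.Frame H] :
    (∃ e : (Hᵒᵖ ⥤ Type u) ≌ RelSh.RelPresheaf H,
      e.functor = RelSh.DeltaPre H ∧ e.inverse = RelSh.ThetaPre H) ∧
    (∃ e : (Hᵒᵖ ⥤ Type u) ≌ RelSh.SHV (LowerSet H),
      e.functor = RelSh.Gamma H ∧ e.inverse = RelSh.Lambda H) ∧
    (∃ e : RelSh.SHV (LowerSet H) ≌ RelSh.RelSheaf (LowerSet H),
      e.functor = RelSh.DeltaShv (LowerSet H) ∧ e.inverse = RelSh.ThetaShv (LowerSet H)) ∧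
    (∃ e : RelSh.RelSheaf (LowerSet H) ≌ RelSh.RelPresheaf H,
      e.functor = RelSh.Phi H ∧ e.inverse = RelSh.Psi H) ∧
    Nonempty (RelSh.aShv H ⊣ RelSh.DeltaShv H ⋙ RelSh.ThetaInf H) ∧
    Nonempty (RelSh.DeltaShv H ⋙ RelSh.ThetaInf H ≅ RelSh.shvIncl H) ∧
    Nonempty (RelSh.aRel H ⊣ RelSh.ThetaInf H ⋙ RelSh.DeltaPre H) := by
  let ePre := (RelSh.gammaEquivalence H).trans
    ((RelSh.deltaShvEquivalence (LowerSet H)).trans (RelSh.phiEquivalence H))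
  exact ⟨⟨ePre, rfl, rfl⟩, ⟨RelSh.gammaEquivalence H, rfl, rfl⟩,
    ⟨RelSh.deltaShvEquivalence (LowerSet H), rfl, rfl⟩, ⟨RelSh.phiEquivalence H, rfl, rfl⟩,
    -- `Δ_inf ⊣ Θ_inf` followed by `Θ_Shv ⊣ Δ_Shv`, the equivalence read backwards.
    ⟨(RelSh.deltaThetaAdj H).comp (RelSh.deltaShvEquivalence H).symm.toAdjunction⟩,
    ⟨(RelSh.shvInclIso H).symm⟩,
    -- `Θ_Pre ⊣ Δ_Pre` followed by `Δ_inf ⊣ Θ_inf`.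
    ⟨ePre.symm.toAdjunction.comp (RelSh.deltaThetaAdj H)⟩⟩
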